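/- Conventions. Let $G$ be a locally compact (Hausdorff) group that is compactly generated, i.e. generated by some compact subset $S$, and let $|\cdot|_S$ and $d_S(g,h)=|g^{-1}h|_S$ be the word length and word metric of $S$. Given a sequence $\mathbf s=(s_n)$ of positive reals tending to infinity and a non-principal ultrafilter $\omega$ on $\mathbb N$, the asymptotic cone $\mathrm{Cone}^\omega(G,d_S,\mathbf s)$ is the set of sequences $(g_n)$ in $G$ for which there is $C>0$ with $|g_n|_S\le C s_n$ for all $n$, modulo the relation $d_\omega=0$, with the metric $d_\omega((g_n),(h_n))=\lim^\omega d_S(g_n,h_n)/s_n$. The group $G$ is called lacunary hyperbolic if one of its asymptotic cones is a real tree (a geodesic $0$-hyperbolic metric space). A measurable subgroup $H\le G$ has relative exponential growth in $G$ if, for some compact generating set $S$ of $G$ and some left Haar measure $\mu$ on $G$, there is $\rho>1$ with $\mu(\{h\in H : |h|_S\le n\})\ge\rho^n$ for every $n\ge 1$. A group $\Gamma$ satisfies a law if there are $k$ and a non-trivial reduced word $w(x_1,\dots,x_k)$ such that $w(g_1,\dots,g_k)=1$ for all $g_1,\dots,g_k\in\Gamma$. Theorem. Let $G$ be a unimodular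 lacunary hyperbolic locally compact group and let $H\le G$ be a subgroup that is compactly generated (for the subspace topology) and has relative exponential growth in $G$. Assume that $H$ has no discrete subgroup $Z\cong\mathbb Z$ that is cocompact in $H$ (i.e. with $H/Z$ compact). Then $H$ does not satisfy a law. -/

import Mathlib

open Filter Topology MeasureTheory
open scoped Pointwise

noncomputable section

namespace LacunaryHyp

/-! ### Geodesic spaces, hyperbolicity, real trees -/

/-- `A` is (the image of) a geodesic segment of `X` from `x` to `y`. -/
def IsGeodesicSegment {X : Type*} [MetricSpace X] (x y : X) (A : Set X) : Prop :=
  ∃ γ : ℝ → X, γ 0 = x ∧ γ (dist x y) = y ∧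
    (∀ t ∈ Set.Icc 0 (dist x y), ∀ u ∈ Set.Icc 0 (dist x y), dist (γ t) (γ u) = |t - u|) ∧
    A = γ '' Set.Icc 0 (dist x y)

/-- Any two points are joined by a geodesic segment. -/
def IsGeodesicSpace (X : Type*) [MetricSpace X] : Prop :=
  ∀ x y : X, ∃ A : Set X, IsGeodesicSegment x y A

/-- Any side of any geodesic triangle lies in the closed `δ`-neighbourhood of the union of the two
other sides. -/
def HasThinTriangles (X : Type*) [MetricSpace X] (δ : ℝ) : Prop :=
  ∀ (x y z : X) (A B C : Set X),
    IsGeodesicSegment x y A → IsGeodesicSegment y z B → IsGeodesicSegment z x C →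
    ∀ p ∈ A, ∃ q ∈ B ∪ C, dist p q ≤ δ

/-- A real tree: a geodesic `0`-hyperbolic metric space. -/
def IsRealTree (X : Type*) [MetricSpace X] : Prop :=
  IsGeodesicSpace X ∧ HasThinTriangles X 0

/-! ### Asymptotic cones -/

/-- A scaling sequence: positive real numbers tending to infinity. -/
structure ScalingSequence where
  /-- The underlying sequence. -/
  seq : ℕ → ℝ
  pos : ∀ n, 0 < seq n
  tendsto : Tendsto seq atTop atTop

/-- The ultrafilter `ω` on `ℕ` is non-principal: it contains no singleton. -/
def IsNonPrincipal (ω : Ultrafilter ℕ) : Prop :=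
  ∀ n : ℕ, ({n} : Set ℕ) ∉ ω

/-- The `s`-linear sequences of points of `X` (with respect to the base point `e`). The ultrafilter
`ω` only enters in the pseudometric put on this set below. -/
def Precone (X : Type*) [MetricSpace X] (e : X) (s : ScalingSequence) (_ω : Ultrafilter ℕ) :
    Type _ :=
  {x : ℕ → X // ∃ C : ℝ, 0 < C ∧ ∀ n, dist (x n) e ≤ C * s.seq n}

section Precone

variable {X : Type*} [MetricSpace X] {e : X} {s : ScalingSequence} {ω : Ultrafilter ℕ}

/-- `d_ω(x, y)`, the limit of `d(x_n, y_n) / s_n` along `ω`. -/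
def ultraDist (x y : Precone X e s ω) : ℝ :=
  limUnder (ω : Filter ℕ) (fun n => dist (x.1 n) (y.1 n) / s.seq n)

/-- The limit defining `d_ω` exists. -/
theorem tendsto_ultraDist (x y : Precone X e s ω) :
    Tendsto (fun n => dist (x.1 n) (y.1 n) / s.seq n) ω (𝓝 (ultraDist x y)) := by
  obtain ⟨C, _, hC⟩ := x.2
  obtain ⟨D, _, hD⟩ := y.2
  have hmem : ∀ n, dist (x.1 n) (y.1 n) / s.seq n ∈ Set.Icc (0 : ℝ) (C + D) := by
    intro n
    have hs := s.pos n
    refine ⟨by positivity, ?_⟩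
    rw [div_le_iff₀ hs]
    have := dist_triangle_right (x.1 n) (y.1 n) e
    have h1 := hC n
    have h2 := hD n
    linarith
  obtain ⟨l, _, hl⟩ := (isCompact_Icc (a := (0 : ℝ)) (b := C + D)).ultrafilter_le_nhds
    (ω.map (fun n => dist (x.1 n) (y.1 n) / s.seq n))
    (by
      rw [Filter.le_principal_iff]
      exact Filter.mem_map.2 (Filter.Eventually.of_forall hmem))
  exact tendsto_nhds_limUnder ⟨l, hl⟩

/-- `d_ω` is a pseudometric on the set of `s`-linear sequences. -/
instance : PseudoMetricSpace (Precone X e s ω) where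
  dist := ultraDist
  dist_self x := by
    refine tendsto_nhds_unique (tendsto_ultraDist x x) ?_
    simp
  dist_comm x y := by
    refine tendsto_nhds_unique (tendsto_ultraDist x y) ?_
    simpa only [dist_comm] using tendsto_ultraDist y x
  dist_triangle x y z := by
    refine le_of_tendsto_of_tendsto' (tendsto_ultraDist x z)
      ((tendsto_ultraDist x y).add (tendsto_ultraDist y z)) fun n => ?_
    rw [← add_div]
    exact div_le_div_of_nonneg_right (dist_triangle _ _ _) (s.pos n).le

end Precone

/-- The asymptotic cone of `X`: the `s`-linear sequences modulo being at `d_ω`-distance zero, with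
the metric induced by `d_ω`. -/
abbrev AsymptoticCone (X : Type*) [MetricSpace X] (e : X) (s : ScalingSequence)
    (ω : Ultrafilter ℕ) : Type _ :=
  SeparationQuotient (Precone X e s ω)

/-! ### Word metrics -/

section Word

variable {G : Type*} [Group G]

/-- The word length with respect to `S`: the least `n` such that `g` is a product of `n` elements
of `S ∪ S⁻¹`. It is only used when `S` generates `G`. -/
def wordLength (S : Set G) (g : G) : ℕ :=
  sInf {n : ℕ | g ∈ (S ∪ S⁻¹) ^ n}

/-- The closed ball of radius `n` around the identity in the word metric of `S`. -/
def wordBall (S : Set G) (n : ℕ) : Set G :=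
  {g : G | wordLength S g ≤ n}

theorem exists_mem_pow {S : Set G} (hS : Subgroup.closure S = ⊤) (g : G) :
    ∃ n : ℕ, g ∈ (S ∪ S⁻¹) ^ n := by
  have hg : g ∈ Submonoid.closure (S ∪ S⁻¹) := by
    rw [← Subgroup.closure_toSubmonoid, hS]
    trivial
  induction hg using Submonoid.closure_induction with
  | mem x hx => exact ⟨1, by simpa using hx⟩
  | one => exact ⟨0, by simp⟩
  | mul x y _ _ hx hy =>
    obtain ⟨m, hm⟩ := hx
    obtain ⟨n, hn⟩ := hy
    exact ⟨m + n, by rw [pow_add]; exact Set.mul_mem_mul hm hn⟩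

theorem mem_pow_wordLength {S : Set G} (hS : Subgroup.closure S = ⊤) (g : G) :
    g ∈ (S ∪ S⁻¹) ^ wordLength S g :=
  Nat.sInf_mem (exists_mem_pow hS g)

theorem wordLength_le {S : Set G} {g : G} {n : ℕ} (h : g ∈ (S ∪ S⁻¹) ^ n) :
    wordLength S g ≤ n :=
  Nat.sInf_le h

theorem wordLength_one (S : Set G) : wordLength S (1 : G) = 0 :=
  Nat.le_zero.1 (wordLength_le (by simp))

theorem wordLength_inv_le {S : Set G} (hS : Subgroup.closure S = ⊤) (g : G) :
    wordLength S g⁻¹ ≤ wordLength S g := by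
  refine wordLength_le ?_
  have h := Set.inv_mem_inv.2 (mem_pow_wordLength hS g)
  rwa [← inv_pow, Set.union_inv, inv_inv, Set.union_comm] at h

theorem wordLength_mul_le {S : Set G} (hS : Subgroup.closure S = ⊤) (g h : G) :
    wordLength S (g * h) ≤ wordLength S g + wordLength S h := by
  refine wordLength_le ?_
  rw [pow_add]
  exact Set.mul_mem_mul (mem_pow_wordLength hS g) (mem_pow_wordLength hS h)

/-- The word metric `d_S(g, h) = |g⁻¹ h|_S`. -/
def wordDist (S : Set G) (g h : G) : ℝ := (wordLength S (g⁻¹ * h) : ℝ)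

theorem wordDist_self (S : Set G) (g : G) : wordDist S g g = 0 := by
  simp [wordDist, wordLength_one]

theorem wordDist_comm {S : Set G} (hS : Subgroup.closure S = ⊤) (g h : G) :
    wordDist S g h = wordDist S h g := by
  have key : ∀ a b : G, wordLength S (a⁻¹ * b) ≤ wordLength S (b⁻¹ * a) := fun a b => by
    simpa using wordLength_inv_le hS (b⁻¹ * a)
  exact congrArg (Nat.cast (R := ℝ)) (le_antisymm (key g h) (key h g))

theorem wordDist_triangle {S : Set G} (hS : Subgroup.closure S = ⊤) (g h k : G) :
    wordDist S g k ≤ wordDist S g h + wordDist S h k := by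
  have key : wordLength S (g⁻¹ * k) ≤ wordLength S (g⁻¹ * h) + wordLength S (h⁻¹ * k) := by
    simpa [mul_assoc] using wordLength_mul_le hS (g⁻¹ * h) (h⁻¹ * k)
  unfold wordDist
  exact_mod_cast key

theorem eq_of_wordDist_eq_zero {S : Set G} (hS : Subgroup.closure S = ⊤) {g h : G}
    (hgh : wordDist S g h = 0) : g = h := by
  have h0 : wordLength S (g⁻¹ * h) = 0 := by
    unfold wordDist at hgh
    exact_mod_cast hgh
  have := mem_pow_wordLength hS (g⁻¹ * h)
  rw [h0, pow_zero, Set.mem_one] at this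
  exact inv_mul_eq_one.1 this

/-- The group `G`, viewed as a metric space for the word metric of a generating set `S`. -/
def WordSpace (S : Set G) (_hS : Subgroup.closure S = ⊤) : Type _ := G

/-- The identity element, as a point of `G` with its word metric. -/
def WordSpace.base (S : Set G) (hS : Subgroup.closure S = ⊤) : WordSpace S hS := (1 : G)

instance (S : Set G) (hS : Subgroup.closure S = ⊤) : MetricSpace (WordSpace S hS) where
  dist := wordDist (G := G) S
  dist_self := wordDist_self (G := G) S
  dist_comm := wordDist_comm (G := G) hS
  dist_triangle := wordDist_triangle (G := G) hS
  eq_of_dist_eq_zero := eq_of_wordDist_eq_zero (G := G) hS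

end Word

/-! ### Group-theoretic notions of the statement -/

/-- `S` is a compact generating subset of `G`. -/
structure IsCompactGenerating {G : Type*} [Group G] [TopologicalSpace G] (S : Set G) : Prop where
  isCompact : IsCompact S
  closure_eq : Subgroup.closure S = ⊤

/-- The topological group `G` is compactly generated. -/
def IsCompactlyGenerated (G : Type*) [Group G] [TopologicalSpace G] : Prop :=
  ∃ S : Set G, IsCompactGenerating S

/-- A (locally compact) group is lacunary hyperbolic if it is compactly generated and one of its
asymptotic cones, taken with respect to the word metric of a compact generating subset, is a real
tree. -/
def IsLacunaryHyperbolic (G : Type*) [Group G] [TopologicalSpace G] : Prop :=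
  ∃ (S : Set G) (hS : IsCompactGenerating S) (s : ScalingSequence) (ω : Ultrafilter ℕ),
    IsNonPrincipal ω ∧
    IsRealTree
      (AsymptoticCone (WordSpace S hS.closure_eq) (WordSpace.base S hS.closure_eq) s ω)

/-- A locally compact group is unimodular if its modular function is trivial. -/
def IsUnimodular (G : Type*) [Group G] [TopologicalSpace G] [IsTopologicalGroup G]
    [LocallyCompactSpace G] : Prop :=
  ∀ g : G, Measure.modularCharacter g = 1

/-- The measurable subgroup `H` has relative exponential growth in `G`: for some compact generating
subset `S` of `G`, some left Haar measure `μ` on `G` and some `ρ > 1`, the intersection of `H` with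
the `n`-ball of `G` around the identity has measure at least `ρ ^ n`, for all `n ≥ 1`. -/
def HasRelativeExponentialGrowth {G : Type*} [Group G] [TopologicalSpace G]
    [MeasurableSpace G] [BorelSpace G] (H : Subgroup G) : Prop :=
  MeasurableSet (H : Set G) ∧
  ∃ (S : Set G) (μ : Measure G) (ρ : ℝ), IsCompactGenerating S ∧
    μ.IsHaarMeasure ∧ μ.Regular ∧ 1 < ρ ∧
    ∀ n : ℕ, 1 ≤ n → ENNReal.ofReal (ρ ^ n) ≤ μ ((H : Set G) ∩ wordBall S n)

/-- The topological group `H` has a discrete cocompact subgroup isomorphic to `ℤ`. -/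
def HasDiscreteCocompactZ (H : Type*) [Group H] [TopologicalSpace H] : Prop :=
  ∃ Z : Subgroup H, Nonempty (Z ≃* Multiplicative ℤ) ∧ DiscreteTopology Z ∧ CompactSpace (H ⧸ Z)

/-- The group `Γ` satisfies a law: there is a non-trivial reduced word `w(x₁, …, xₙ)` with
`w(g₁, …, gₙ) = 1` for all `g₁, …, gₙ` in `Γ`. -/
def SatisfiesLaw (Γ : Type*) [Group Γ] : Prop :=
  ∃ (n : ℕ) (w : FreeGroup (Fin n)), w ≠ 1 ∧ ∀ g : Fin n → Γ, FreeGroup.lift g w = 1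

end LacunaryHyp

end

noncomputable section

namespace LacunaryHyp

/-! ### Gromov products and `0`-hyperbolic spaces -/

section Gromov

variable {X : Type*} [PseudoMetricSpace X]

/-! Let Γ be the group of sequences in `H` of length O(s_n) in `G` (`linearSubgroup`). A law of `H`
holds coordinatewise in Γ, so it suffices to find free subgroups of Γ. For this Γ acts isometrically
on the linear sequences in `G`, a pseudometric space that inherits `0`-hyperbolicity and midpoints
from the real tree.

Growth enters through `hasLargeLocalOrbits_of_growth`: no point is sent into finitely many ε-balls
by all elements of displacement at most `1` at the base point. Otherwise, for a suitable large n, a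
part of `H` of measure exponential in s_n would be covered by boundedly many two-sided translates of
a ball of radius ε s_n. By unimodularity these have the measure of the ball, which is too small for
small ε.

Large local orbits yield free subgroups (`HasLargeLocalOrbits.exists_free`). If no element
translates, the elements of displacement at most `1` almost fix a common point
(`IsElliptic.exists_almost_fixed`), which is excluded. So some g has an axis. Large local orbits
move its two ends, by elements of bounded displacement, into infinitely many pairwise divergent
directions, and ping-pong applies (`lift_ne_one_of_gromovProduct_lt`). -/

/-- The Gromov product of `x` and `y` based at `o`. -/
def gromovProduct (o x y : X) : ℝ := (dist o x + dist o y - dist x y) / 2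

/-- `0`-hyperbolicity in the sense of Gromov. -/
def IsZeroHyperbolic (X : Type*) [PseudoMetricSpace X] : Prop :=
  ∀ o x y z : X, min (gromovProduct o x y) (gromovProduct o y z) ≤ gromovProduct o x z

/-- Any two points have a midpoint. -/
def HasMidpoints (X : Type*) [PseudoMetricSpace X] : Prop :=
  ∀ x y : X, ∃ m : X, dist x m = dist x y / 2 ∧ dist m y = dist x y / 2

theorem gromovProduct_comm (o x y : X) : gromovProduct o x y = gromovProduct o y x := by
  unfold gromovProduct
  rw [dist_comm x y]
  ring

theorem gromovProduct_le_add (o x y x' y' : X) :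
    gromovProduct o x y ≤ gromovProduct o x' y' + dist x x' + dist y y' := by
  unfold gromovProduct
  have h1 := dist_triangle_right o x x'
  have h2 := dist_triangle_right o y y'
  have h3 := dist_triangle4 x' x y y'
  rw [dist_comm x' x] at h3
  linarith

theorem IsZeroHyperbolic.trans (hX : IsZeroHyperbolic X) {o x y z : X} {c : ℝ}
    (hxy : c ≤ gromovProduct o x y) (hyz : c ≤ gromovProduct o y z) : c ≤ gromovProduct o x z :=
  (le_min hxy hyz).trans (hX o x y z)

end Gromov

/-! ### Real trees are `0`-hyperbolic -/

section RealTree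

variable {X : Type*} [MetricSpace X]

theorem IsGeodesicSegment.dist_add {x y : X} {A : Set X} (hA : IsGeodesicSegment x y A) {p : X}
    (hp : p ∈ A) : dist x p + dist p y = dist x y := by
  obtain ⟨γ, h0, h1, hγ, rfl⟩ := hA
  obtain ⟨t, ht, rfl⟩ := hp
  have hd : (0 : ℝ) ≤ dist x y := dist_nonneg
  have e1 := hγ 0 ⟨le_rfl, hd⟩ t ht
  have e2 := hγ t ht _ ⟨hd, le_rfl⟩
  rw [h0] at e1
  rw [h1] at e2
  rw [e1, e2, abs_of_nonpos (by linarith [ht.1]), abs_of_nonpos (by linarith [ht.2])]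
  ring

theorem IsGeodesicSegment.left_mem {x y : X} {A : Set X} (hA : IsGeodesicSegment x y A) :
    x ∈ A := by
  obtain ⟨γ, h0, -, -, rfl⟩ := hA
  exact ⟨0, ⟨le_rfl, dist_nonneg⟩, h0⟩

theorem IsGeodesicSegment.right_mem {x y : X} {A : Set X} (hA : IsGeodesicSegment x y A) :
    y ∈ A := by
  obtain ⟨γ, -, h1, -, rfl⟩ := hA
  exact ⟨_, ⟨dist_nonneg, le_rfl⟩, h1⟩

theorem IsGeodesicSegment.isCompact_isPreconnected {x y : X} {A : Set X}
    (hA : IsGeodesicSegment x y A) : IsCompact A ∧ IsPreconnected A := by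
  obtain ⟨γ, -, -, hγ, rfl⟩ := hA
  have hc : ContinuousOn γ (Set.Icc 0 (dist x y)) := by
    rw [Metric.continuousOn_iff]
    intro b hb ε hε
    refine ⟨ε, hε, fun a ha hab => ?_⟩
    rwa [hγ a ha b hb, ← Real.dist_eq]
  exact ⟨isCompact_Icc.image_of_continuousOn hc, isPreconnected_Icc.image _ hc⟩

theorem IsRealTree.hasMidpoints (hX : IsRealTree X) : HasMidpoints X := by
  intro x y
  obtain ⟨A, γ, h0, h1, hγ, -⟩ := hX.1 x y
  have hd : (0 : ℝ) ≤ dist x y := dist_nonneg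
  have hm : dist x y / 2 ∈ Set.Icc 0 (dist x y) := ⟨by linarith, by linarith⟩
  refine ⟨γ (dist x y / 2), ?_, ?_⟩
  · have := hγ 0 ⟨le_rfl, hd⟩ _ hm
    rw [h0] at this
    rw [this, zero_sub, abs_neg, abs_of_nonneg hm.1]
  · have := hγ _ hm _ ⟨hd, le_rfl⟩
    rw [h1] at this
    rw [this, abs_of_nonpos (by linarith)]
    ring

/-- Geodesic triangles in real trees are tripods. -/
theorem IsRealTree.exists_center (hX : IsRealTree X) {x y o : X} {A B C : Set X}
    (hA : IsGeodesicSegment x y A) (hB : IsGeodesicSegment y o B)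
    (hC : IsGeodesicSegment o x C) : ∃ m ∈ A, dist o m = gromovProduct o x y := by
  have hsub : A ⊆ B ∪ C := fun p hp => by
    obtain ⟨q, hq, hpq⟩ := hX.2 x y o A B C hA hB hC p hp
    rwa [dist_le_zero.1 hpq]
  -- The connected side `A` is covered by the closed sides `B` and `C` and meets both, so it meets
  -- their intersection.
  obtain ⟨m, hmA, hmB, hmC⟩ := isPreconnected_closed_iff.1 hA.isCompact_isPreconnected.2 B C
    hB.isCompact_isPreconnected.1.isClosed hC.isCompact_isPreconnected.1.isClosed hsub
    ⟨y, hA.right_mem, hB.left_mem⟩ ⟨x, hA.left_mem, hC.right_mem⟩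
  refine ⟨m, hmA, ?_⟩
  have h1 := hA.dist_add hmA
  have h2 := hB.dist_add hmB
  have h3 := hC.dist_add hmC
  unfold gromovProduct
  rw [dist_comm x m] at h1
  rw [dist_comm y m, dist_comm m o, dist_comm y o] at h2
  linarith

theorem IsGeodesicSegment.gromovProduct_le {x y : X} {A : Set X} (hA : IsGeodesicSegment x y A)
    {m : X} (hm : m ∈ A) (o : X) : gromovProduct o x y ≤ dist o m := by
  have h1 := hA.dist_add hm
  have h2 := dist_triangle o m x
  have h3 := dist_triangle o m y
  unfold gromovProduct
  rw [dist_comm x m] at h1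
  linarith

/-- The centre of the triangle x, z, o realises the product of x and z. By thinness it lies on a
side through y, and every point of that side is at least as far from o as the corresponding product.
-/
theorem IsRealTree.isZeroHyperbolic (hX : IsRealTree X) : IsZeroHyperbolic X := by
  intro o x y z
  obtain ⟨A, hA⟩ := hX.1 x z
  obtain ⟨B, hB⟩ := hX.1 z o
  obtain ⟨C, hC⟩ := hX.1 o x
  obtain ⟨B', hB'⟩ := hX.1 z y
  obtain ⟨C', hC'⟩ := hX.1 y x
  obtain ⟨m, hm, hmd⟩ := hX.exists_center hA hB hC
  obtain ⟨q, hq, hmq⟩ := hX.2 x z y A B' C' hA hB' hC' m hm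
  rw [← dist_le_zero.1 hmq] at hq
  rw [← hmd]
  rcases hq with hq | hq
  · exact (min_le_right _ _).trans
      (gromovProduct_comm o y z ▸ hB'.gromovProduct_le hq o)
  · exact (min_le_left _ _).trans
      (gromovProduct_comm o x y ▸ hC'.gromovProduct_le hq o)

end RealTree

/-! ### Isometric actions on `0`-hyperbolic spaces -/

section Action

variable {X : Type*} [PseudoMetricSpace X] {Γ : Type*} [Group Γ] [MulAction Γ X]
  [IsIsometricSMul Γ X]

theorem dist_inv_smul_right (g : Γ) (x y : X) : dist x (g⁻¹ • y) = dist (g • x) y := by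
  rw [← dist_smul g x, smul_inv_smul]

theorem dist_inv_smul_left (g : Γ) (x y : X) : dist (g⁻¹ • x) y = dist x (g • y) := by
  rw [← dist_smul g _ y, smul_inv_smul]

/-! ### Almost fixed points of groups without translations -/

/-- No element of `Γ` has positive translation length. -/
def IsElliptic (Γ X : Type*) [PseudoMetricSpace X] [Group Γ] [MulAction Γ X] : Prop :=
  ∀ (g : Γ) (x : X), dist x (g • g • x) ≤ dist x (g • x)

/-- If hx and kx diverged earlier, consecutive terms of the chain hx, h⁻¹x, h⁻¹kx, k⁻¹hx, k⁻¹x, kx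
would still have product at least half the displacement of h. The first, third and last links use
that h, h⁻¹k and k do not translate. Transitivity along the chain is then contradictory. -/
theorem IsElliptic.le_gromovProduct (hX : IsZeroHyperbolic X) (hΓ : IsElliptic Γ X) (h k : Γ)
    (x : X) (hk : dist x (h • x) ≤ dist x (k • x)) :
    dist x (h • x) / 2 ≤ gromovProduct x (h • x) (k • x) := by
  by_contra! hlt
  have f1 : dist x (h • x) / 2 ≤ gromovProduct x (h • x) (h⁻¹ • x) := by
    have := hΓ h x
    unfold gromovProduct
    rw [dist_inv_smul_right, dist_inv_smul_right, dist_comm (h • x) x, dist_comm _ x]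
    linarith
  have f2 : dist x (h • x) / 2 ≤ gromovProduct x (k⁻¹ • x) (k • x) := by
    have := hΓ k x
    unfold gromovProduct
    rw [dist_inv_smul_right, dist_inv_smul_left, dist_comm (k • x) x]
    linarith
  have f3 : dist x (h • x) / 2 ≤ gromovProduct x (k⁻¹ • x) (k⁻¹ • h • x) := by
    unfold gromovProduct at hlt ⊢
    rw [dist_smul, dist_inv_smul_right, dist_inv_smul_right, dist_comm (k • x) x,
      dist_comm (k • x) (h • x)]
    linarith
  have f4 : dist x (h • x) / 2 ≤ gromovProduct x (h⁻¹ • k • x) (h⁻¹ • x) := by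
    unfold gromovProduct at hlt ⊢
    rw [dist_smul, dist_inv_smul_right, dist_inv_smul_right, dist_comm (h • x) x,
      dist_comm (k • x) x]
    linarith
  have f5 : dist x (h • x) / 2 ≤ gromovProduct x (k⁻¹ • h • x) (h⁻¹ • k • x) := by
    have := hΓ (h⁻¹ * k) x
    unfold gromovProduct at hlt ⊢
    simp only [mul_smul] at this
    rw [dist_inv_smul_left, dist_inv_smul_right k, dist_inv_smul_right h,
      dist_comm (k • x) (h • x)]
    rw [dist_inv_smul_right, dist_inv_smul_right] at this
    linarith
  have := hX.trans (hX.trans (hX.trans (hX.trans f1 (gromovProduct_comm x _ _ ▸ f4))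
    (gromovProduct_comm x _ _ ▸ f5)) (gromovProduct_comm x _ _ ▸ f3)) f2
  linarith

/-- Seen from hx, the points x and h²x agree for at least half the displacement of h, hence up to
both m and hm, which are equally far from hx. -/
theorem IsElliptic.dist_midpoint (hX : IsZeroHyperbolic X) (hΓ : IsElliptic Γ X) (h : Γ) {x m : X}
    (h1 : dist x m = dist x (h • x) / 2) (h2 : dist m (h • x) = dist x (h • x) / 2) :
    dist m (h • m) = 0 := by
  have h3 := hΓ h x
  have a1 : dist x (h • x) / 2 ≤ gromovProduct (h • x) m x := by
    unfold gromovProduct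
    rw [dist_comm (h • x) m, dist_comm (h • x) x, dist_comm m x]
    linarith
  have a2 : dist x (h • x) / 2 ≤ gromovProduct (h • x) x (h • h • x) := by
    unfold gromovProduct
    rw [dist_smul, dist_comm (h • x) x]
    linarith
  have a3 : dist x (h • x) / 2 ≤ gromovProduct (h • x) (h • h • x) (h • m) := by
    unfold gromovProduct
    rw [dist_smul, dist_smul, dist_smul, dist_comm (h • x) m]
    linarith
  have := hX.trans a1 (hX.trans a2 a3)
  unfold gromovProduct at this
  rw [dist_smul, dist_comm (h • x) m] at this
  have h0 : 0 ≤ dist m (h • m) := dist_nonneg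
  linarith

theorem IsElliptic.dist_midpoint_midpoint (hX : IsZeroHyperbolic X) (hΓ : IsElliptic Γ X)
    (h k : Γ) {x m n : X} (hk : dist x (h • x) ≤ dist x (k • x))
    (h1 : dist x m = dist x (h • x) / 2) (h2 : dist m (h • x) = dist x (h • x) / 2)
    (k1 : dist x n = dist x (k • x) / 2) (k2 : dist n (k • x) = dist x (k • x) / 2) :
    dist m n ≤ (dist x (k • x) - dist x (h • x)) / 2 := by
  have a1 : dist x (h • x) / 2 ≤ gromovProduct x m (h • x) := by
    unfold gromovProduct
    linarith
  have a2 := hΓ.le_gromovProduct hX h k x hk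
  have a3 : dist x (h • x) / 2 ≤ gromovProduct x (k • x) n := by
    unfold gromovProduct
    rw [dist_comm (k • x) n]
    linarith
  have := hX.trans a1 (hX.trans a2 a3)
  unfold gromovProduct at this
  linarith

/-- Let q be the midpoint of m and hm, fixed by h. Then m is the midpoint of q and kq, so hm is that
of q and its image under hkh⁻¹. Both elements displace q equally, which forces m and hm to be at
distance zero. -/
theorem IsElliptic.dist_smul_midpoint (hX : IsZeroHyperbolic X) (hM : HasMidpoints X)
    (hΓ : IsElliptic Γ X) (h k : Γ) {x m : X} (hk : dist x (h • x) ≤ dist x (k • x))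
    (k1 : dist x m = dist x (k • x) / 2) (k2 : dist m (k • x) = dist x (k • x) / 2) :
    dist m (h • m) = 0 := by
  -- The midpoint `q` of `m` and `h m` is fixed by `h` and lies between `x` and `m`.
  obtain ⟨q, q1, q2⟩ := hM m (h • m)
  have hq : dist q (h • q) = 0 := hΓ.dist_midpoint hX h q1 q2
  have hmk : dist m (k • m) = 0 := hΓ.dist_midpoint hX k k1 k2
  have a1 : dist x (h • m) ≤ dist x m := by
    have e1 : dist x (h⁻¹ • x) = dist x (h • x) := by rw [dist_inv_smul_right, dist_comm]
    have b1 := hΓ.le_gromovProduct hX h⁻¹ k x (e1 ▸ hk)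
    have b2 : dist x (h⁻¹ • x) / 2 ≤ gromovProduct x (k • x) m := by
      unfold gromovProduct
      rw [dist_comm (k • x) m]
      linarith
    have := hX.trans b1 b2
    unfold gromovProduct at this
    rw [dist_inv_smul_left] at this
    linarith
  have a2 : dist x q ≤ dist x m - dist m (h • m) / 2 := by
    have e : gromovProduct q m (h • m) = 0 := by
      unfold gromovProduct
      rw [dist_comm q m]
      linarith
    have := hX q m x (h • m)
    rw [e, min_le_iff] at this
    unfold gromovProduct at this
    rw [dist_comm q m, dist_comm q x, dist_comm m x] at this
    rcases this with h | h <;> linarith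
  have a3 : dist q (k • q) = dist m (h • m) := by
    apply le_antisymm
    · have := dist_triangle4 q m (k • m) (k • q)
      rw [dist_smul, dist_comm q m] at this
      linarith
    · have := dist_triangle4 x q (k • q) (k • x)
      rw [dist_smul, dist_comm q x] at this
      linarith
  have a4 : dist q ((h * k * h⁻¹) • q) = dist q (k • q) := by
    have b1 : dist ((h * k * h⁻¹) • q) (h • k • q) = 0 := by
      rw [mul_smul, mul_smul, dist_smul, dist_smul, dist_inv_smul_left, hq]
    have b2 : dist (h • q) (h • k • q) = dist q (k • q) := dist_smul _ _ _
    apply le_antisymm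
    · have := dist_triangle4 q (h • q) (h • k • q) ((h * k * h⁻¹) • q)
      rw [dist_comm (h • k • q)] at this
      linarith
    · have := dist_triangle4 (h • q) q ((h * k * h⁻¹) • q) (h • k • q)
      rw [dist_comm (h • q) q] at this
      linarith
  have a5 := hΓ.dist_midpoint_midpoint hX k (h * k * h⁻¹) (x := q) (m := m) (n := h • m)
    a4.ge (by rw [dist_comm, q1, a3]) (by
      apply le_antisymm
      · have := dist_triangle m (k • m) (k • q)
        rw [dist_smul] at this
        linarith
      · have := dist_triangle q m (k • q)
        rw [dist_comm q m] at this
        linarith) (by rw [q2, a4, a3]) (by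
      have b1 : dist ((h * k * h⁻¹) • q) (h • k • q) = 0 := by
        rw [mul_smul, mul_smul, dist_smul, dist_smul, dist_inv_smul_left, hq]
      have b2 : dist (h • k • m) (h • k • q) = dist m q := by rw [dist_smul, dist_smul]
      have b3 : dist (h • m) (h • k • m) = 0 := by rw [dist_smul, hmk]
      rw [a4, a3]
      apply le_antisymm
      · have := dist_triangle4 (h • m) (h • k • m) (h • k • q) ((h * k * h⁻¹) • q)
        rw [dist_comm (h • k • q)] at this
        linarith
      · have := dist_triangle q (h • m) ((h * k * h⁻¹) • q)
        linarith)
  have h0 : 0 ≤ dist m (h • m) := dist_nonneg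
  linarith

/-- In a group without elements of positive translation length, the elements of bounded
displacement have an almost fixed point in common. -/
theorem IsElliptic.exists_almost_fixed (hX : IsZeroHyperbolic X) (hM : HasMidpoints X)
    (hΓ : IsElliptic Γ X) (o : X) {δ : ℝ} (hδ : 0 < δ) :
    ∃ p : X, ∀ h : Γ, dist o (h • o) ≤ 1 → dist (h • p) p ≤ δ := by
  set D : Set ℝ := {d | d ≤ 1 ∧ ∃ k : Γ, dist o (k • o) = d} with hD
  have hne : D.Nonempty := ⟨0, zero_le_one, 1, by simp⟩
  have hbd : BddAbove D := ⟨1, fun d hd => hd.1⟩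
  -- The largest displacement need not be attained. A `k` within `δ` of it suffices: smaller
  -- displacements fix the midpoint, larger ones move it by at most the excess.
  obtain ⟨d, ⟨hd1, k, hk⟩, hd⟩ := exists_lt_of_lt_csSup hne (sub_lt_self (sSup D) hδ)
  obtain ⟨p, p1, p2⟩ := hM o (k • o)
  refine ⟨p, fun h hh => ?_⟩
  rcases le_total (dist o (h • o)) (dist o (k • o)) with hle | hle
  · rw [dist_comm, hΓ.dist_smul_midpoint hX hM h k hle p1 p2]
    exact hδ.le
  · obtain ⟨m, m1, m2⟩ := hM o (h • o)
    have a1 := hΓ.dist_midpoint_midpoint hX k h hle p1 p2 m1 m2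
    have a2 := hΓ.dist_midpoint hX h m1 m2
    have a3 : dist o (h • o) ≤ sSup D := le_csSup hbd ⟨hh, h, rfl⟩
    have a4 := dist_triangle4 p m (h • m) (h • p)
    rw [dist_smul, dist_comm m p, dist_comm p (h • p)] at a4
    linarith

/-! ### Free subgroups -/

/-- Ping-pong: the image of p under a reduced word keeps the direction of its first letter up to
distance K. -/
theorem lift_ne_one_of_gromovProduct_lt (hX : IsZeroHyperbolic X) {ι : Type*} [DecidableEq ι] (x : ι → Γ)
    (p : X)
    {K : ℝ} (hK : 0 < K) (hx : ∀ i, 2 * K ≤ dist p (x i • p))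
    (hxx : ∀ a b : ι × Bool, a ≠ b → gromovProduct p (cond a.2 (x a.1) (x a.1)⁻¹ • p)
      (cond b.2 (x b.1) (x b.1)⁻¹ • p) < K)
    {w : FreeGroup ι} (hw : w ≠ 1) : FreeGroup.lift x w ≠ 1 := by
  set f : ι × Bool → Γ := fun a => cond a.2 (x a.1) (x a.1)⁻¹ with hf
  have hfK : ∀ a, 2 * K ≤ dist p (f a • p) := by
    rintro ⟨i, _ | _⟩
    · simpa [hf, dist_inv_smul_right, dist_comm] using hx i
    · exact hx i
  have hfinv : ∀ a : ι × Bool, (f a)⁻¹ = f (a.1, !a.2) := by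
    rintro ⟨i, _ | _⟩ <;> simp [hf]
  have key : ∀ (L : List (ι × Bool)) (a : ι × Bool), FreeGroup.IsReduced (a :: L) →
      K ≤ gromovProduct p ((((a :: L).map f).prod) • p) (f a • p) := by
    intro L
    induction L with
    | nil =>
      intro a _
      have := hfK a
      simp [gromovProduct]
      linarith
    | cons b L ih =>
      intro a hab
      rw [FreeGroup.isReduced_cons_cons] at hab
      have h1 := ih b hab.2
      set W := ((b :: L).map f).prod with hW
      -- `W` starts with `b`, which is not the inverse of `a`, so at most `K` cancels; since `f a`
      -- displaces `p` by at least `2 * K`, at least `K` remains.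
      have h2 : gromovProduct p (W • p) ((f a)⁻¹ • p) < K := by
        by_contra! hcon
        have h3 := hX.trans (gromovProduct_comm p _ _ ▸ h1) hcon
        rw [hfinv] at h3
        refine absurd h3 (not_le.2 (hxx b (a.1, !a.2) ?_))
        rintro rfl
        simpa using hab.1 rfl
      rw [List.map_cons, List.prod_cons, mul_smul, ← hW]
      have h4 := hfK a
      unfold gromovProduct at h2 ⊢
      rw [dist_inv_smul_right, dist_inv_smul_right, dist_comm (f a • p) p] at h2
      rw [dist_smul]
      linarith [dist_comm (f a • W • p) p, dist_comm (W • p) p]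
  intro hone
  have hred := FreeGroup.isReduced_toWord (x := w)
  rw [← FreeGroup.mk_toWord (x := w), FreeGroup.lift_mk] at hone
  cases hL : w.toWord with
  | nil => exact hw (FreeGroup.toWord_eq_nil_iff.1 hL)
  | cons a L =>
    rw [hL] at hone hred
    have h1 := key L a hred
    change ((a :: L).map f).prod = 1 at hone
    rw [hone, one_smul] at h1
    simp [gromovProduct] at h1
    linarith

/-! ### Elements of positive translation length -/

/-- The midpoint p lies on the axis of g: backtracking at gp would propagate to gx and g²x, although
gp lies between these two. -/
theorem axis_midpoint (hX : IsZeroHyperbolic X) (g : Γ) {x p : X}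
    (hg : dist x (g • x) < dist x (g • g • x))
    (h1 : dist x p = dist x (g • x) / 2) (h2 : dist p (g • x) = dist x (g • x) / 2) :
    0 < dist p (g • p) ∧ dist p (g • g • p) = 2 * dist p (g • p) := by
  have e1 : dist (g • x) (g • p) = dist x (g • x) / 2 := by rw [dist_smul, h1]
  have e2 : dist (g • p) (g • g • x) = dist x (g • x) / 2 := by rw [dist_smul, h2]
  have a1 : dist x (g • g • x) - dist x (g • x) ≤ dist p (g • p) := by
    have := dist_triangle4 x p (g • p) (g • g • x)
    linarith
  have hpos : 0 < dist p (g • p) := by linarith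
  refine ⟨hpos, le_antisymm ?_ ?_⟩
  · have := dist_triangle p (g • p) (g • g • p)
    rw [dist_smul] at this
    linarith
  · by_contra! hlt
    set c := min (dist p (g • p) / 2) (gromovProduct (g • p) p (g • g • p)) with hc
    have hcpos : 0 < c := by
      refine lt_min (by linarith) ?_
      unfold gromovProduct
      rw [dist_smul, dist_comm (g • p) p]
      linarith
    have b1 : c ≤ gromovProduct (g • p) (g • x) p := by
      refine (min_le_left _ _).trans ?_
      unfold gromovProduct
      rw [dist_comm (g • p) (g • x), dist_comm (g • p) p, dist_comm (g • x) p]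
      linarith
    have b2 : c ≤ gromovProduct (g • p) p (g • g • p) := min_le_right _ _
    have b3 : c ≤ gromovProduct (g • p) (g • g • p) (g • g • x) := by
      refine (min_le_left _ _).trans ?_
      unfold gromovProduct
      rw [dist_smul, dist_smul, dist_smul, dist_smul, dist_comm p x]
      linarith
    have := hX.trans b1 (hX.trans b2 b3)
    unfold gromovProduct at this
    rw [dist_comm (g • p) (g • x), dist_smul g x (g • x)] at this
    linarith

/-- Local alignment of an orbit propagates, since backtracking at gp would already occur among p,
gp, g²p. The two consecutive exponents make the induction work. -/
theorem dist_pow_smul (hX : IsZeroHyperbolic X) (g : Γ) {p : X} (hpos : 0 < dist p (g • p))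
    (h2 : dist p (g • g • p) = 2 * dist p (g • p)) (n : ℕ) :
    dist p (g ^ n • p) = n * dist p (g • p) ∧
      dist p (g ^ (n + 1) • p) = (n + 1) * dist p (g • p) := by
  induction n with
  | zero => simp
  | succ n ih =>
    refine ⟨by simpa using ih.2, ?_⟩
    have e : g ^ (n + 1 + 1) • p = g • g ^ (n + 1) • p := by rw [pow_succ' g (n + 1), mul_smul]
    have e' : g ^ (n + 1) • p = g • g ^ n • p := by rw [pow_succ' g n, mul_smul]
    have d1 : dist (g • p) (g • g ^ (n + 1) • p) = (n + 1) * dist p (g • p) := by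
      rw [dist_smul, ih.2]
    have d2 : dist (g • g • p) (g • g ^ (n + 1) • p) = n * dist p (g • p) := by
      rw [e', dist_smul, dist_smul, ih.1]
    rw [e]
    push_cast
    apply le_antisymm
    · have := dist_triangle p (g • p) (g • g ^ (n + 1) • p)
      linarith
    · by_contra! hlt
      set c := min (dist p (g • p)) (gromovProduct (g • p) p (g • g ^ (n + 1) • p)) with hc
      have hcpos : 0 < c := by
        refine lt_min hpos ?_
        unfold gromovProduct
        rw [d1, dist_comm (g • p) p]
        linarith
      have b1 : c ≤ gromovProduct (g • p) (g • g ^ (n + 1) • p) (g • g • p) := by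
        refine (min_le_left _ _).trans ?_
        unfold gromovProduct
        rw [d1, dist_comm (g • g ^ (n + 1) • p), d2, dist_smul]
        linarith
      have := hcpos.trans_le (hX.trans (min_le_right _ _ : c ≤ _) b1)
      unfold gromovProduct at this
      rw [h2, dist_smul g p (g • p), dist_comm (g • p) p] at this
      linarith

/-! ### Divergent translates and free subgroups -/

/-- If `u a` and `z` fellow-travel long enough when seen from `p`, then the translate by `u` of a
point `q` between `p` and `a` lies between `p` and `z`. -/
theorem dist_add_of_lt_gromovProduct (hX : IsZeroHyperbolic X) (u : Γ) {p q a z : X} {D : ℝ}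
    (hu : dist p (u • p) ≤ D) (hqa : dist p a = dist p q + dist q a) (hq : D < dist p q)
    (hz : D + dist p q < gromovProduct p (u • a) z) :
    dist p (u • q) + dist (u • q) z = dist p z := by
  have a1 : dist p (u • q) ≤ D + dist p q := by
    have := dist_triangle p (u • p) (u • q)
    rw [dist_smul] at this
    linarith
  have a2 : dist p (u • q) ≤ gromovProduct p (u • q) (u • a) := by
    have h1 := hX (u • p) p (u • a) (u • q)
    unfold gromovProduct at h1 ⊢
    simp only [dist_smul, dist_comm (u • p) p, dist_comm (u • a) (u • q)] at h1 ⊢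
    have h0 : 0 ≤ dist p (u • q) := dist_nonneg
    rcases min_le_iff.1 h1 with h | h <;> linarith [dist_comm a q]
  have a3 := hX.trans a2 (a1.trans hz.le)
  unfold gromovProduct at a3
  have := dist_triangle p (u • q) z
  linarith

/-- By `0`-hyperbolicity, the distance to p embeds this set isometrically in a bounded interval. -/
theorem totallyBounded_between (hX : IsZeroHyperbolic X) (p z : X) :
    TotallyBounded {y : X | dist p y + dist y z = dist p z} := by
  set A : Set X := {y : X | dist p y + dist y z = dist p z} with hA
  have hiso : Isometry (fun y : A => dist p y) := by
    refine Isometry.of_dist_eq fun x y => ?_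
    rw [Real.dist_eq, Subtype.dist_eq]
    have hx : dist p x + dist (x : X) z = dist p z := x.2
    have hy : dist p y + dist (y : X) z = dist p z := y.2
    apply le_antisymm
      (by simpa [dist_comm] using abs_dist_sub_le (x : X) (y : X) p)
    have := hX p x z y
    unfold gromovProduct at this
    rw [dist_comm z (y : X)] at this
    rcases min_le_iff.1 this with h | h
    · exact le_trans (by linarith) (neg_le_abs _)
    · exact le_trans (by linarith) (le_abs_self _)
  have h1 : TotallyBounded (Set.univ : Set A) := by
    refine (totallyBounded_preimage hiso.isUniformInducing
      (totallyBounded_Icc 0 (dist p z))).subset fun y _ => ?_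
    have hy : dist p y + dist (y : X) z = dist p z := y.2
    have : 0 ≤ dist (y : X) z := dist_nonneg
    exact ⟨dist_nonneg, by change dist p y ≤ dist p z; linarith⟩
  have h2 := h1.image uniformContinuous_subtype_val
  rwa [Set.image_univ, Subtype.range_coe] at h2

/-- An action of `Γ` has large local orbits if the displacement-`1` part of `Γ` never moves a point
inside finitely many balls of some fixed radius. -/
def HasLargeLocalOrbits (Γ : Type*) {X : Type*} [PseudoMetricSpace X] [Group Γ] [MulAction Γ X]
    (o : X) : Prop :=
  ∃ ε : ℝ, 0 < ε ∧ ∀ (p : X) (F : Set X), F.Finite →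
    ∃ h : Γ, dist o (h • o) ≤ 1 ∧ ∀ q ∈ F, ε ≤ dist (h • p) q

/-- A product exceeding the bound puts uq between p and some z in Z. These points form a totally
bounded set, and a suitable u moves q out of a finite ε-cover of it. -/
theorem HasLargeLocalOrbits.exists_gromovProduct_le (hX : IsZeroHyperbolic X) {o : X}
    (hΓ : HasLargeLocalOrbits Γ o) {p q a : X}
    (hqa : dist p a = dist p q + dist q a) (hq : 1 + 2 * dist o p < dist p q) (Z : Finset X) :
    ∃ u : Γ, dist p (u • p) ≤ 1 + 2 * dist o p ∧
      ∀ z ∈ Z, gromovProduct p (u • a) z ≤ 1 + 2 * dist o p + dist p q := by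
  obtain ⟨ε, hε, hΓ⟩ := hΓ
  have htb : TotallyBounded (⋃ z ∈ (Z : Set X), {y : X | dist p y + dist y z = dist p z}) :=
    (totallyBounded_biUnion Z.finite_toSet).2 fun z _ => totallyBounded_between hX p z
  obtain ⟨F, hF, hcov⟩ := Metric.totallyBounded_iff.1 htb ε hε
  obtain ⟨u, hu, hud⟩ := hΓ q F hF
  have hup : dist p (u • p) ≤ 1 + 2 * dist o p := by
    have := dist_triangle4 p o (u • o) (u • p)
    rw [dist_smul, dist_comm p o] at this
    linarith
  refine ⟨u, hup, fun z hz => ?_⟩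
  by_contra! hlt
  have h1 := dist_add_of_lt_gromovProduct hX u hup hqa hq hlt
  obtain ⟨y, hy, hyd⟩ := Set.mem_iUnion₂.1 (hcov (Set.mem_biUnion (Finset.mem_coe.2 hz) h1))
  exact absurd (hud y hy) (not_le.2 hyd)

/-- A group acting on a `0`-hyperbolic space with midpoints with large local orbits contains free
groups of all finite ranks. -/
theorem HasLargeLocalOrbits.exists_free (hX : IsZeroHyperbolic X) (hM : HasMidpoints X) {o : X}
    (hΓ : HasLargeLocalOrbits Γ o) :
    ∃ x : ℕ → Γ, ∀ w : FreeGroup ℕ, w ≠ 1 → FreeGroup.lift x w ≠ 1 := by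
  classical
  by_cases hell : IsElliptic Γ X
  · exfalso
    obtain ⟨ε, hε, hlarge⟩ := hΓ
    obtain ⟨p, hp⟩ := hell.exists_almost_fixed hX hM o (half_pos hε)
    obtain ⟨h, hh, hhp⟩ := hlarge p {p} (Set.finite_singleton p)
    have h1 := hp h hh
    have h2 := hhp p rfl
    linarith
  unfold IsElliptic at hell
  push Not at hell
  obtain ⟨g, x₀, hg⟩ := hell
  obtain ⟨p, p1, p2⟩ := hM x₀ (g • x₀)
  obtain ⟨hpos, htwo⟩ := axis_midpoint hX g hg p1 p2
  set l := dist p (g • p) with hl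
  have hinv : dist p (g⁻¹ • p) = l := by rw [dist_inv_smul_right, dist_comm]
  have hpow : ∀ n : ℕ, dist p (g ^ n • p) = n * l := fun n =>
    (dist_pow_smul hX g hpos htwo n).1
  have hpow' : ∀ n : ℕ, dist p (g⁻¹ ^ n • p) = n * l := fun n => by
    rw [inv_pow, dist_inv_smul_right, dist_comm, hpow]
  have hmid : ∀ (f : Γ) (m n : ℕ), (∀ n : ℕ, dist p (f ^ n • p) = n * l) → m ≤ n →
      dist p (f ^ n • p) = dist p (f ^ m • p) + dist (f ^ m • p) (f ^ n • p) := by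
    intro f m n hf hmn
    obtain ⟨k, rfl⟩ := Nat.exists_eq_add_of_le hmn
    rw [pow_add, mul_smul, dist_smul, ← mul_smul, ← pow_add, hf, hf, hf]
    push_cast
    ring
  set D := 1 + 2 * dist o p with hD
  have hDpos : 0 < D := by positivity
  -- `m` puts the m-th orbit point further than `D` from `p`; `M` then bounds the products of the
  -- chosen directions, and `N` makes the translation exceed twice the ping-pong constant `M + 2 * D
  -- + 1` plus the error `2 * D`.
  obtain ⟨m, hm⟩ := exists_nat_gt (D / l)
  rw [div_lt_iff₀ hpos] at hm
  set M := D + m * l with hMdef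
  obtain ⟨N₀, hN₀⟩ := exists_nat_gt ((2 * (M + 2 * D + 1) + 2 * D) / l)
  rw [div_lt_iff₀ hpos] at hN₀
  set N := m + N₀ with hN
  have hNl : 2 * (M + 2 * D + 1) + 2 * D ≤ N * l := by
    rw [hN]
    push_cast
    nlinarith
  have hchoose : ∀ f : Γ, (∀ n : ℕ, dist p (f ^ n • p) = n * l) → ∀ Z : Finset X,
      ∃ u : Γ, dist p (u • p) ≤ D ∧ ∀ z ∈ Z, gromovProduct p (u • f ^ N • p) z ≤ M := by
    intro f hf Z
    have := hΓ.exists_gromovProduct_le hX (hmid f m N hf (Nat.le_add_right _ _))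
      (by rw [hf]; exact hm) Z
    rwa [hf, ← hD, ← hMdef] at this
  obtain ⟨t, ht, htt⟩ := exists_seq_of_forall_finset_exists
    (fun t : Γ × Γ => dist p (t.1 • p) ≤ D ∧ dist p (t.2 • p) ≤ D ∧
      gromovProduct p (t.1 • g ^ N • p) (t.2 • g⁻¹ ^ N • p) ≤ M)
    (fun s t : Γ × Γ => gromovProduct p (t.1 • g ^ N • p) (s.1 • g ^ N • p) ≤ M ∧
      gromovProduct p (t.1 • g ^ N • p) (s.2 • g⁻¹ ^ N • p) ≤ M ∧
      gromovProduct p (t.2 • g⁻¹ ^ N • p) (s.1 • g ^ N • p) ≤ M ∧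
      gromovProduct p (t.2 • g⁻¹ ^ N • p) (s.2 • g⁻¹ ^ N • p) ≤ M) (by
    intro s _
    set Z : Finset X := s.image (fun t => t.1 • g ^ N • p) ∪
      s.image (fun t => t.2 • g⁻¹ ^ N • p) with hZ
    obtain ⟨u, hu, huZ⟩ := hchoose g hpow Z
    obtain ⟨v, hv, hvZ⟩ := hchoose g⁻¹ hpow' (insert (u • g ^ N • p) Z)
    have m1 : ∀ t ∈ s, t.1 • g ^ N • p ∈ Z := fun t ht =>
      Finset.mem_union_left _ (Finset.mem_image_of_mem _ ht)
    have m2 : ∀ t ∈ s, t.2 • g⁻¹ ^ N • p ∈ Z := fun t ht =>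
      Finset.mem_union_right _ (Finset.mem_image_of_mem (fun t => t.2 • g⁻¹ ^ N • p) ht)
    refine ⟨(u, v), ⟨hu, hv, ?_⟩, fun t ht => ⟨huZ _ (m1 t ht), huZ _ (m2 t ht),
      hvZ _ (Finset.mem_insert_of_mem (m1 t ht)), hvZ _ (Finset.mem_insert_of_mem (m2 t ht))⟩⟩
    rw [gromovProduct_comm]
    exact hvZ _ (Finset.mem_insert_self _ _))
  set y : ℕ × Bool → X := fun a =>
    cond a.2 ((t a.1).1 • g ^ N • p) ((t a.1).2 • g⁻¹ ^ N • p) with hy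
  have hyy : ∀ a b, a ≠ b → gromovProduct p (y a) (y b) ≤ M := by
    rintro ⟨i, b⟩ ⟨j, c⟩ hne
    rcases lt_trichotomy i j with hij | rfl | hij
    · have := htt i j hij
      rw [gromovProduct_comm]
      cases b <;> cases c <;> simp only [hy, cond_true, cond_false] <;> tauto
    · have := (ht i).2.2
      cases b <;> cases c <;> simp only [hy, cond_true, cond_false] at hne ⊢
      · exact absurd rfl hne
      · rwa [gromovProduct_comm]
      · exact this
      · exact absurd rfl hne
    · have := htt j i hij
      cases b <;> cases c <;> simp only [hy, cond_true, cond_false] <;> tauto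
  -- Each generator and its inverse send `p` to within `D` of the two directions chosen at stage
  -- `i`, which costs `2 * D` in the products.
  refine ⟨fun i => (t i).1 * g ^ N * (t i).2⁻¹, fun w hw =>
    lift_ne_one_of_gromovProduct_lt hX _ p (K := M + 2 * D + 1) (by positivity) ?_ ?_ hw⟩
  · intro i
    have h1 := (ht i).1
    have h2 := (ht i).2.1
    have h3 := dist_triangle4 ((t i).1 • p) p (((t i).1 * g ^ N * (t i).2⁻¹) • p)
      ((t i).1 • g ^ N • p)
    rw [dist_smul, hpow, mul_smul, mul_smul, dist_smul, dist_smul, dist_inv_smul_left,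
      dist_comm _ p] at h3
    rw [mul_smul, mul_smul]
    linarith
  · have hclose : ∀ a : ℕ × Bool, dist (cond a.2 ((t a.1).1 * g ^ N * (t a.1).2⁻¹)
        ((t a.1).1 * g ^ N * (t a.1).2⁻¹)⁻¹ • p) (y a) ≤ D := by
      rintro ⟨i, _ | _⟩
      · simp only [hy, cond_false, mul_inv_rev, inv_inv, mul_smul, inv_pow, dist_smul,
          dist_inv_smul_left]
        exact (ht i).1
      · simp only [hy, cond_true, mul_smul, dist_smul, dist_inv_smul_left]
        exact (ht i).2.1
    intro a b hab
    have h1 := gromovProduct_le_add p (cond a.2 ((t a.1).1 * g ^ N * (t a.1).2⁻¹)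
        ((t a.1).1 * g ^ N * (t a.1).2⁻¹)⁻¹ • p) (cond b.2 ((t b.1).1 * g ^ N * (t b.1).2⁻¹)
        ((t b.1).1 * g ^ N * (t b.1).2⁻¹)⁻¹ • p) (y a) (y b)
    have h2 := hyy a b hab
    have h3 := hclose a
    have h4 := hclose b
    linarith

end Action

/-! ### Balls of word metrics -/

section Balls

variable {G : Type*} [Group G]

theorem wordLength_inv {S : Set G} (hS : Subgroup.closure S = ⊤) (g : G) :
    wordLength S g⁻¹ = wordLength S g :=
  le_antisymm (wordLength_inv_le hS g) (by simpa using wordLength_inv_le hS g⁻¹)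

theorem wordLength_le_mul {S T : Set G} (hS : Subgroup.closure S = ⊤)
    (hT : Subgroup.closure T = ⊤) {c : ℕ} (hc : ∀ t ∈ T, wordLength S t ≤ c) (g : G) :
    wordLength S g ≤ c * wordLength T g := by
  have key : ∀ (n : ℕ) (g : G), g ∈ (T ∪ T⁻¹) ^ n → wordLength S g ≤ c * n := by
    intro n
    induction n with
    | zero =>
      intro g hg
      rw [pow_zero, Set.mem_one] at hg
      simp [hg, wordLength_one]
    | succ n ih =>
      intro g hg
      rw [pow_succ] at hg
      obtain ⟨a, ha, b, hb, rfl⟩ := hg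
      have h1 := wordLength_mul_le hS a b
      have h2 := ih a ha
      have h3 : wordLength S b ≤ c := by
        rcases hb with hb | hb
        · exact hc b hb
        · rw [← wordLength_inv hS]
          exact hc _ hb
      change wordLength S (a * b) ≤ c * (n + 1)
      rw [mul_add, mul_one]
      lia
  exact key _ g (mem_pow_wordLength hT g)

variable [TopologicalSpace G] [IsTopologicalGroup G]

theorem isCompact_pow {S : Set G} (hS : IsCompact S) (n : ℕ) : IsCompact (S ^ n) := by
  induction n with
  | zero => simp
  | succ n ih =>
    rw [pow_succ]
    exact ih.mul hS

variable [LocallyCompactSpace G]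

/-- The right translate of μ is a multiple of μ by uniqueness of regular Haar measures, and the
factor is the modular function. -/
theorem IsUnimodular.measure_preimage_mul_right [MeasurableSpace G] [BorelSpace G]
    (hG : IsUnimodular G) (μ : Measure G) [μ.IsHaarMeasure] [μ.Regular] (g : G) (A : Set G) :
    μ ((· * g) ⁻¹' A) = μ A := by
  have h1 : (μ.map (· * g)).Regular := Measure.Regular.map (Homeomorph.mulRight g)
  have h2 : Measure.modularCharacterFun g = 1 := hG g
  have h3 := Measure.isMulLeftInvariant_eq_smul_of_regular (μ.map (· * g)) μ
  rw [← Measure.modularCharacterFun_eq_haarScalarFactor, h2, one_smul] at h3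
  have h4 := (Homeomorph.mulRight g).measurableEmbedding.map_apply μ A
  rw [Homeomorph.coe_mulRight, h3] at h4
  exact h4.symm

/-- The word lengths of two compact generating sets are comparable. -/
theorem IsCompactGenerating.exists_wordLength_le_mul [T2Space G] {S T : Set G} (hS : IsCompactGenerating S)
    (hT : IsCompactGenerating T) :
    ∃ c : ℕ, 0 < c ∧ ∀ g, wordLength S g ≤ c * wordLength T g := by
  have hSc : IsCompact (S ∪ S⁻¹) := hS.isCompact.union hS.isCompact.inv
  -- Baire category: one of the compact powers has interior, so finitely many translates of it cover
  -- `T`.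
  obtain ⟨n, hn⟩ := nonempty_interior_of_iUnion_of_closed
    (f := fun n : ℕ => (S ∪ S⁻¹) ^ n) (fun n => (isCompact_pow hSc n).isClosed)
    (Set.eq_univ_of_forall fun g => Set.mem_iUnion.2 (exists_mem_pow hS.closure_eq g))
  obtain ⟨F, hF⟩ := compact_covered_by_mul_left_translates hT.isCompact hn
  refine ⟨F.sup (wordLength S) + n + 1, by positivity,
    wordLength_le_mul hS.closure_eq hT.closure_eq fun t ht => ?_⟩
  obtain ⟨f, hf, hft⟩ := Set.mem_iUnion₂.1 (hF ht)
  have h1 : wordLength S (f * t) ≤ n := wordLength_le hft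
  have h2 := wordLength_mul_le hS.closure_eq f⁻¹ (f * t)
  rw [inv_mul_cancel_left, wordLength_inv hS.closure_eq] at h2
  have h3 : wordLength S f ≤ F.sup (wordLength S) := Finset.le_sup hf
  lia

/-- Balls of word metrics grow at most exponentially. -/
theorem IsCompactGenerating.exists_measure_wordBall_le [MeasurableSpace G] [BorelSpace G]
    {S : Set G} (hS : IsCompactGenerating S) (μ : Measure G) [μ.IsHaarMeasure] :
    ∃ (K : ℕ) (V : Set G), μ V ≠ ⊤ ∧ ∀ k, μ (wordBall S k) ≤ (K : ENNReal) ^ k * μ V := by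
  classical
  obtain ⟨U, hU, hU1⟩ := exists_compact_mem_nhds (1 : G)
  set V : Set G := (S ∪ S⁻¹) ∪ U with hV
  have hVc : IsCompact V := (hS.isCompact.union hS.isCompact.inv).union hU
  have hV1 : V ∈ 𝓝 (1 : G) := Filter.mem_of_superset hU1 Set.subset_union_right
  have h1V : (1 : G) ∈ V := mem_of_mem_nhds hV1
  -- Covering V² by finitely many translates of V gives, by iteration, a cover of V^(k+1) by at most
  -- |E|^k translates. Adding `U` ensures that V has interior.
  obtain ⟨F, hF⟩ := compact_covered_by_mul_left_translates (hVc.mul hVc)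
    ⟨1, mem_interior_iff_mem_nhds.2 hV1⟩
  set E := F⁻¹ with hE
  have hVV : V * V ⊆ (E : Set G) * V := by
    intro x hx
    obtain ⟨f, hf, hfx⟩ := Set.mem_iUnion₂.1 (hF hx)
    exact ⟨f⁻¹, by simpa [hE] using hf, f * x, hfx, by simp⟩
  have hpow : ∀ k : ℕ, V ^ (k + 1) ⊆ (E : Set G) ^ k * V := by
    intro k
    induction k with
    | zero => simp
    | succ k ih =>
      calc V ^ (k + 1 + 1) = V ^ (k + 1) * V := pow_succ _ _
        _ ⊆ (E : Set G) ^ k * V * V := Set.mul_subset_mul_right ih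
        _ = (E : Set G) ^ k * (V * V) := mul_assoc _ _ _
        _ ⊆ (E : Set G) ^ k * ((E : Set G) * V) := Set.mul_subset_mul_left hVV
        _ = (E : Set G) ^ (k + 1) * V := by rw [← mul_assoc, ← pow_succ]
  refine ⟨E.card, V, hVc.measure_lt_top.ne, fun k => ?_⟩
  have hball : wordBall S k ⊆ ⋃ a ∈ E ^ k, a • V := by
    intro g hg
    have h1 : g ∈ V ^ (k + 1) := Set.pow_subset_pow_right h1V (hg.trans (Nat.le_succ k))
      (Set.pow_subset_pow_left Set.subset_union_left (mem_pow_wordLength hS.closure_eq g))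
    obtain ⟨a, ha, v, hv, rfl⟩ := hpow k h1
    rw [← Finset.coe_pow] at ha
    exact Set.mem_biUnion (Finset.mem_coe.1 ha) ⟨v, hv, rfl⟩
  calc μ (wordBall S k) ≤ μ (⋃ a ∈ E ^ k, a • V) := measure_mono hball
    _ ≤ ∑ a ∈ E ^ k, μ (a • V) := measure_biUnion_finset_le _ _
    _ = (E ^ k).card * μ V := by simp [measure_smul]
    _ ≤ (E.card : ENNReal) ^ k * μ V := by
      gcongr
      exact_mod_cast Finset.card_pow_le

end Balls

/-! ### The action of the linearly bounded sequences on the cone -/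

section Cone

variable {G : Type*} [Group G]

/-- The sequences in `H` whose word length in `G` grows at most linearly with respect to `s`. -/
def linearSubgroup {S : Set G} (hS : Subgroup.closure S = ⊤) (H : Subgroup G)
    (s : ScalingSequence) : Subgroup (ℕ → H) where
  carrier := {h | ∃ C : ℝ, 0 < C ∧ ∀ n, (wordLength S (h n : G) : ℝ) ≤ C * s.seq n}
  one_mem' := ⟨1, one_pos, fun n => by simpa [wordLength_one] using (s.pos n).le⟩
  mul_mem' := by
    rintro a b ⟨C, hC, ha⟩ ⟨D, hD, hb⟩
    refine ⟨C + D, by positivity, fun n => ?_⟩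
    have h1 : (wordLength S (a n * b n : G) : ℝ) ≤ wordLength S (a n : G) + wordLength S (b n : G) :=
      mod_cast wordLength_mul_le hS _ _
    have := ha n
    have := hb n
    change (wordLength S (a n * b n : G) : ℝ) ≤ _
    linarith
  inv_mem' := by
    rintro a ⟨C, hC, ha⟩
    refine ⟨C, hC, fun n => ?_⟩
    change (wordLength S (a n : G)⁻¹ : ℝ) ≤ _
    rw [wordLength_inv hS]
    exact ha n

variable {S : Set G} {hS : Subgroup.closure S = ⊤} {H : Subgroup G} {s : ScalingSequence}
  {ω : Ultrafilter ℕ}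

/-- The `n`-th term of a linear sequence, as an element of the group. -/
def Precone.eval (x : Precone (WordSpace S hS) (WordSpace.base S hS) s ω) (n : ℕ) : G := x.1 n

theorem Precone.dist_eval (x y : Precone (WordSpace S hS) (WordSpace.base S hS) s ω) (n : ℕ) :
    dist (x.1 n) (y.1 n) = wordDist S (x.eval n) (y.eval n) := rfl

theorem wordDist_mul_left (S : Set G) (g x y : G) :
    wordDist S (g * x) (g * y) = wordDist S x y := by
  unfold wordDist
  rw [mul_inv_rev, mul_assoc, inv_mul_cancel_left]

theorem wordDist_one_right (hS : Subgroup.closure S = ⊤) (g : G) :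
    wordDist S g 1 = wordLength S g := by
  rw [wordDist, mul_one, wordLength_inv hS]

instance : MulAction (linearSubgroup hS H s) (Precone (WordSpace S hS) (WordSpace.base S hS) s ω)
    where
  smul h x := ⟨fun n => ((h.1 n : G) * x.eval n : G), by
    obtain ⟨C, hC, hh⟩ := h.2
    obtain ⟨D, hD, hx⟩ := x.2
    refine ⟨C + D, by positivity, fun n => ?_⟩
    have h1 : wordDist S (x.eval n) 1 ≤ D * s.seq n := hx n
    have h2 := hh n
    have h3 := wordDist_triangle hS ((h.1 n : G) * x.eval n) ((h.1 n : G) * 1) 1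
    rw [wordDist_mul_left, mul_one, wordDist_one_right hS (h.1 n : G)] at h3
    change wordDist S ((h.1 n : G) * x.eval n) 1 ≤ _
    linarith⟩
  one_smul x := Subtype.ext (funext fun n => one_mul (x.eval n))
  mul_smul g h x := Subtype.ext (funext fun n => mul_assoc (g.1 n : G) (h.1 n : G) (x.eval n))

theorem Precone.eval_smul (h : linearSubgroup hS H s)
    (x : Precone (WordSpace S hS) (WordSpace.base S hS) s ω) (n : ℕ) :
    (h • x).eval n = (h.1 n : G) * x.eval n := rfl

instance : IsIsometricSMul (linearSubgroup hS H s)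
    (Precone (WordSpace S hS) (WordSpace.base S hS) s ω) where
  isometry_smul h := Isometry.of_dist_eq fun x y => by
    refine tendsto_nhds_unique (tendsto_ultraDist (h • x) (h • y)) ?_
    refine (tendsto_ultraDist x y).congr fun n => ?_
    simp only [Precone.dist_eval, Precone.eval_smul, wordDist_mul_left]

/-- The base point of the cone. -/
def Precone.base (S : Set G) (hS : Subgroup.closure S = ⊤) (s : ScalingSequence)
    (ω : Ultrafilter ℕ) : Precone (WordSpace S hS) (WordSpace.base S hS) s ω :=
  ⟨fun _ => WordSpace.base S hS, 1, one_pos, fun n => by simpa using (s.pos n).le⟩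

theorem IsNonPrincipal.le_atTop (hω : IsNonPrincipal ω) : (ω : Filter ℕ) ≤ atTop := by
  rcases ω.le_cofinite_or_eq_pure with h | ⟨a, rfl⟩
  · rwa [Nat.cofinite_eq_atTop] at h
  · exact absurd (Ultrafilter.mem_pure.2 (Set.mem_singleton a)) (hω a)

variable [TopologicalSpace G] [IsTopologicalGroup G]
  [LocallyCompactSpace G] [MeasurableSpace G] [BorelSpace G]

/-- A is covered by the sets q_i B p⁻¹, with B the ball; left invariance and unimodularity give each
the measure of B. -/
theorem measure_inter_wordBall_le (hG : IsUnimodular G) (μ : Measure G) [μ.IsHaarMeasure]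
    [μ.Regular] {T : Set G} {k : ℕ} (A : Set G) (p : G) {ι : Type*} (F : Finset ι) (q : ι → G)
    (hA : ∀ h ∈ A, ∃ i ∈ F, (q i)⁻¹ * (h * p) ∈ wordBall T k) :
    μ A ≤ F.card * μ (wordBall T k) := by
  have hsub : A ⊆ ⋃ i ∈ F, (· * p) ⁻¹' ((fun x => (q i)⁻¹ * x) ⁻¹' wordBall T k) := fun h hh =>
    Set.mem_iUnion₂.2 (by simpa using hA h hh)
  calc μ A ≤ ∑ i ∈ F, μ ((· * p) ⁻¹' ((fun x => (q i)⁻¹ * x) ⁻¹' wordBall T k)) :=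
        (measure_mono hsub).trans (measure_biUnion_finset_le _ _)
    _ = F.card * μ (wordBall T k) := by
      simp only [hG.measure_preimage_mul_right, measure_preimage_mul, Finset.sum_const,
        nsmul_eq_mul]

/-- A subgroup of relative exponential growth has large local orbits in the cone. -/
theorem hasLargeLocalOrbits_of_growth [T2Space G] (hSc : IsCompact S) (hG : IsUnimodular G)
    (hω : IsNonPrincipal ω) (hH : HasRelativeExponentialGrowth H) :
    HasLargeLocalOrbits (linearSubgroup hS H s) (Precone.base S hS s ω) := by
  classical
  obtain ⟨-, T, μ, ρ, hT, hμ, hμr, hρ, hgrow⟩ := hH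
  have hSg : IsCompactGenerating S := ⟨hSc, hS⟩
  obtain ⟨c, hc, hcT⟩ := hSg.exists_wordLength_le_mul hT
  obtain ⟨K, V, hV, hK⟩ := hSg.exists_measure_wordBall_le μ
  have hc' : (0 : ℝ) < c := mod_cast hc
  set r := Real.log ρ with hr
  have hrpos : 0 < r := Real.log_pos hρ
  set κ := Real.log (K + 2) with hκ
  have hκpos : 0 < κ := Real.log_pos (by linarith [(Nat.cast_nonneg K : (0 : ℝ) ≤ K)])
  -- With this ε, balls of radius ε s_n have measure O(exp(r s_n / 2c)), while the part of `H` of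
  -- `S`-length at most s_n has measure at least about exp(r s_n / c). The `2` in `K + 2` keeps κ
  -- positive.
  refine ⟨r / (2 * c * κ), by positivity, fun p F hF => ?_⟩
  set ε := r / (2 * c * κ) with hε
  have hεpos : 0 < ε := by positivity
  have hεκ : ε * κ = r / (2 * c) := by
    rw [hε]
    field_simp
  lift F to Finset (Precone (WordSpace S hS) (WordSpace.base S hS) s ω) using hF
  let P : ℕ → H → Prop := fun n h => (wordLength S (h : G) : ℝ) ≤ s.seq n ∧
    ∀ q ∈ F, ε * s.seq n ≤ wordDist S ((h : G) * p.eval n) (q.eval n)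
  by_cases hP : ∀ᶠ n in (ω : Filter ℕ), ∃ h, P n h
  · let h : ℕ → H := fun n => if hn : ∃ h, P n h then hn.choose else 1
    have hle : ∀ n, (wordLength S (h n : G) : ℝ) ≤ s.seq n := by
      intro n
      by_cases hn : ∃ h, P n h
      · simp only [h, dif_pos hn]
        exact hn.choose_spec.1
      · simp only [h, dif_neg hn, OneMemClass.coe_one, wordLength_one, Nat.cast_zero]
        exact (s.pos n).le
    refine ⟨⟨h, 1, one_pos, fun n => by simpa using hle n⟩, ?_, fun q hq => ?_⟩
    · refine le_of_tendsto' (tendsto_ultraDist _ _) fun n => ?_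
      rw [div_le_one (s.pos n), dist_comm]
      change wordDist S ((h n : G) * 1) 1 ≤ s.seq n
      rw [mul_one, wordDist_one_right hS]
      exact hle n
    · refine ge_of_tendsto (tendsto_ultraDist _ _) ?_
      filter_upwards [hP] with n hn
      rw [le_div_iff₀ (s.pos n)]
      change _ ≤ wordDist S ((h n : G) * p.eval n) (q.eval n)
      simp only [h, dif_pos hn]
      exact hn.choose_spec.2 q hq
  · exfalso
    rw [← Ultrafilter.eventually_not] at hP
    set A : ℝ := F.card * (μ V).toReal with hA
    -- The summand `c` gives `j ≥ 1`, where the growth bound applies; the other summand makes the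
    -- exponent in `e3` at least `A`, against exp(x) ≥ x + 1.
    have hlarge := hω.le_atTop (s.tendsto.eventually_ge_atTop (c + (A + r) * (2 * c) / r))
    obtain ⟨n, hn, hsn⟩ := (hP.and hlarge).exists
    push Not at hn
    set j := ⌊s.seq n / c⌋₊ with hj
    set k := ⌊ε * s.seq n⌋₊ with hk
    have hA0 : 0 ≤ A := by positivity
    have hj1 : 1 ≤ j := by
      rw [hj, Nat.one_le_floor_iff, one_le_div hc']
      have : 0 ≤ (A + r) * (2 * c) / r := by positivity
      linarith
    have hcov : μ ((H : Set G) ∩ wordBall T j) ≤ F.card * μ (wordBall S k) := by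
      refine measure_inter_wordBall_le hG μ _ (p.eval n) F
        (fun q => q.eval n) ?_
      rintro h ⟨hhH, hhT⟩
      have h1 : (wordLength S h : ℝ) ≤ s.seq n := by
        have e1 : (wordLength S h : ℝ) ≤ c * wordLength T h := mod_cast hcT h
        have e2 : (wordLength T h : ℝ) ≤ s.seq n / c :=
          (Nat.cast_le.2 hhT).trans (Nat.floor_le (div_nonneg (s.pos n).le hc'.le))
        rw [le_div_iff₀ hc'] at e2
        linarith
      have h2 : ∃ q ∈ F, wordDist S (h * p.eval n) (q.eval n) < ε * s.seq n := by
        by_contra! hcon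
        exact hn ⟨h, hhH⟩ ⟨h1, hcon⟩
      obtain ⟨q, hq, hlt⟩ := h2
      refine ⟨q, hq, Nat.le_floor ?_⟩
      rw [wordDist_comm hS] at hlt
      exact hlt.le
    have hreal : ρ ^ j ≤ A * (K + 2 : ℝ) ^ k := by
      have h1 := (hgrow j hj1).trans (hcov.trans (mul_le_mul_right (hK k) _))
      have h2 := ENNReal.toReal_mono (by finiteness) h1
      rw [ENNReal.toReal_ofReal (by positivity)] at h2
      simp only [ENNReal.toReal_mul, ENNReal.toReal_pow, ENNReal.toReal_natCast] at h2
      calc ρ ^ j ≤ F.card * ((K : ℝ) ^ k * (μ V).toReal) := h2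
        _ = A * (K : ℝ) ^ k := by rw [hA]; ring
        _ ≤ A * (K + 2 : ℝ) ^ k := by
          gcongr
          linarith
    have e1 : Real.exp ((s.seq n / c - 1) * r) ≤ ρ ^ j := by
      rw [← Real.exp_log (show 0 < ρ by linarith), ← Real.exp_nat_mul, ← hr]
      refine Real.exp_le_exp.2 (mul_le_mul_of_nonneg_right ?_ hrpos.le)
      linarith [Nat.lt_floor_add_one (s.seq n / c)]
    have e2 : (K + 2 : ℝ) ^ k ≤ Real.exp (s.seq n * (r / (2 * c))) := by
      rw [← Real.exp_log (show (0 : ℝ) < K + 2 by positivity), ← Real.exp_nat_mul, ← hκ, ← hεκ]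
      refine Real.exp_le_exp.2 ?_
      have := Nat.floor_le (mul_pos hεpos (s.pos n)).le
      nlinarith
    have e3 : Real.exp ((s.seq n / c - 1) * r - s.seq n * (r / (2 * c))) ≤ A := by
      rw [Real.exp_sub, div_le_iff₀ (Real.exp_pos _)]
      exact e1.trans (hreal.trans (mul_le_mul_of_nonneg_left e2 hA0))
    have e4 := Real.add_one_le_exp ((s.seq n / c - 1) * r - s.seq n * (r / (2 * c)))
    have e5 : (s.seq n / c - 1) * r - s.seq n * (r / (2 * c)) = s.seq n * (r / (2 * c)) - r := by
      field_simp
      ring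
    have e6 : A + r ≤ s.seq n * (r / (2 * c)) := by
      have : (A + r) * (2 * c) / r ≤ s.seq n := by linarith
      rw [div_le_iff₀ hrpos] at this
      rw [← mul_div_assoc, le_div_iff₀ (by positivity)]
      exact this
    linarith

end Cone

/-! ### From the cone to sequences, and laws of sequence groups -/

theorem IsRealTree.isZeroHyperbolic_precone {X : Type*} [MetricSpace X] {e : X}
    {s : ScalingSequence} {ω : Ultrafilter ℕ} (hX : IsRealTree (AsymptoticCone X e s ω)) :
    IsZeroHyperbolic (Precone X e s ω) := fun o x y z =>
  hX.isZeroHyperbolic (SeparationQuotient.mk o) (SeparationQuotient.mk x)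
    (SeparationQuotient.mk y) (SeparationQuotient.mk z)

theorem IsRealTree.hasMidpoints_precone {X : Type*} [MetricSpace X] {e : X}
    {s : ScalingSequence} {ω : Ultrafilter ℕ} (hX : IsRealTree (AsymptoticCone X e s ω)) :
    HasMidpoints (Precone X e s ω) := fun x y => by
  obtain ⟨m, hm⟩ := hX.hasMidpoints (SeparationQuotient.mk x) (SeparationQuotient.mk y)
  obtain ⟨m, rfl⟩ := SeparationQuotient.surjective_mk m
  exact ⟨m, hm⟩

/-- A law of `H` holds in every group of sequences in `H`. -/
theorem SatisfiesLaw.exists_lift_eq_one {H : Type*} [Group H] (hH : SatisfiesLaw H)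
    (Γ : Subgroup (ℕ → H)) (x : ℕ → Γ) :
    ∃ w : FreeGroup ℕ, w ≠ 1 ∧ FreeGroup.lift x w = 1 := by
  obtain ⟨n, w, hw, hlaw⟩ := hH
  refine ⟨FreeGroup.map Fin.val w, fun h => hw ?_, ?_⟩
  · exact FreeGroup.map_injective Fin.val_injective (h.trans (map_one _).symm)
  · refine Subtype.ext (funext fun m => ?_)
    have h1 : ((Pi.evalMonoidHom (fun _ : ℕ => H) m).comp Γ.subtype).comp
        ((FreeGroup.lift x).comp (FreeGroup.map Fin.val)) =
        FreeGroup.lift fun i : Fin n => (x i).1 m := by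
      ext i
      simp
    have h2 := DFunLike.congr_fun h1 w
    rw [hlaw] at h2
    exact h2

end LacunaryHyp

end

theorem mainTheorem3 {G : Type*} [Group G] [TopologicalSpace G] [IsTopologicalGroup G]
    [T2Space G] [LocallyCompactSpace G] [MeasurableSpace G] [BorelSpace G]
    (hG : LacunaryHyp.IsLacunaryHyperbolic G)
    (hGu : LacunaryHyp.IsUnimodular G)
    (H : Subgroup G)
    (hHc : LacunaryHyp.IsCompactlyGenerated H)
    (hHg : LacunaryHyp.HasRelativeExponentialGrowth H)
    (hHZ : ¬ LacunaryHyp.HasDiscreteCocompactZ H) :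
    ¬ LacunaryHyp.SatisfiesLaw H := by
  intro hlaw
  obtain ⟨S, hS, s, ω, hω, htree⟩ := hG
  obtain ⟨x, hx⟩ := (LacunaryHyp.hasLargeLocalOrbits_of_growth (hS := hS.closure_eq) (s := s)
    hS.isCompact hGu hω hHg).exists_free htree.isZeroHyperbolic_precone htree.hasMidpoints_precone
  obtain ⟨w, hw, hw1⟩ := hlaw.exists_lift_eq_one _ x
  exact hx w hw hw1
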